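/- Let $\mathbb{R}^{2,1}$ be $\mathbb{R}^3$ with coordinates $(x,y,t)$ and the Lorentz metric $\langle\cdot,\cdot\rangle = dx^2+dy^2-dt^2$. A vector $v$ is spacelike if $\langle v,v\rangle>0$. A spacelike hypersurface is a connected smooth surface $M$ with a smooth immersion $F:M\to\mathbb{R}^{2,1}$ such that $dF(v)$ is spacelike for every nonzero tangent vector $v$ of $M$; it is complete if $M$, with the induced Riemannian metric, is complete (every sequence that is Cauchy for the Riemannian distance converges). Let $\gamma$ be a smooth (regular) simple closed curve in $\mathbb{R}^{2,1}$ that lies in (the image of) a complete spacelike hypersurface, and suppose that its curvature vector $\gamma''(s)$, where $s$ is the arc length of $\gamma$ for $\langle\cdot,\cdot\rangle$, is spacelike at every point. Let $T=\gamma'(s)$, $\kappa=\langle\gamma'',\gamma''\rangle^{1/2}$, $N=\gamma''/\kappa$, $B=T\times N$, where $\times$ is the Lorentzian cross product (the Euclidean one with the sign of the $t$ component changed), and let the torsion $\tau$ be defined by $N'=-\kappa T+\tau B$, that is, $\tau=-\langle N',B\rangle$. If $\tau\ge 0$ at every point of $\gamma$, or $\tau\le 0$ at every point of $\gamma$, then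 $\tau\equiv 0$ and $\gamma$ lies in a (two-dimensional affine) plane. -/

import Mathlib

open scoped Manifold ContDiff ENNReal

noncomputable section

namespace Minkowski

/-- The vector space underlying Minkowski space `ℝ^{2,1}`, with coordinates `(x, y, t)` indexed by
`0, 1, 2`. Only its linear, topological and smooth structures are used, never its Euclidean
metric. -/
abbrev R21 : Type := EuclideanSpace ℝ (Fin 3)

/-- The Lorentz metric `dx² + dy² - dt²`. -/
def lorentz (u v : R21) : ℝ := u 0 * v 0 + u 1 * v 1 - u 2 * v 2

/-- A vector is spacelike if the metric is positive on it. -/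
def IsSpacelike (v : R21) : Prop := 0 < lorentz v v

/-- The Lorentzian cross product: the usual one with the sign of the `t` component changed. -/
def cross (u v : R21) : R21 :=
  !₂[u 1 * v 2 - u 2 * v 1, u 2 * v 0 - u 0 * v 2, -(u 0 * v 1 - u 1 * v 0)]

section Curves

/-- `γ` is a regular parametrization of a smooth simple closed curve, of period `L`. -/
structure IsSmoothSimpleClosedCurve (γ : ℝ → R21) (L : ℝ) : Prop where
  period_pos : 0 < L
  smooth : ContDiff ℝ ∞ γ
  regular : ∀ t, deriv γ t ≠ 0
  periodic : Function.Periodic γ L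
  simple : Set.InjOn γ (Set.Ico 0 L)

/-- The speed `ds/dt` of a curve (with spacelike velocity), `s` being its arc length. -/
def speed (γ : ℝ → R21) (t : ℝ) : ℝ := √(lorentz (deriv γ t) (deriv γ t))

/-- The derivative `dX/ds`, with respect to the arc length `s` of `γ`, of a vector field `X`
along `γ`. -/
def arcDeriv (γ X : ℝ → R21) (t : ℝ) : R21 := (speed γ t)⁻¹ • deriv X t

/-- The unit tangent vector `T = dγ/ds`. -/
def tangent (γ : ℝ → R21) : ℝ → R21 := arcDeriv γ γ

/-- The curvature vector `dT/ds = d²γ/ds²`. -/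
def curvatureVector (γ : ℝ → R21) : ℝ → R21 := arcDeriv γ (tangent γ)

/-- The curvature, the length of the (spacelike) curvature vector. -/
def curvature (γ : ℝ → R21) (t : ℝ) : ℝ :=
  √(lorentz (curvatureVector γ t) (curvatureVector γ t))

/-- The unit normal `N`, so that `dT/ds = κ N`. -/
def normal (γ : ℝ → R21) (t : ℝ) : R21 := (curvature γ t)⁻¹ • curvatureVector γ t

/-- The binormal `B = T × N`, a timelike unit vector. -/
def binormal (γ : ℝ → R21) (t : ℝ) : R21 := cross (tangent γ t) (normal γ t)

/-- The torsion `τ`, the coefficient of `B` in the Frenet formula `dN/ds = -κ T + τ B`. The sign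
comes from `⟨B, B⟩ = -1`. -/
def torsion (γ : ℝ → R21) (t : ℝ) : ℝ := -lorentz (arcDeriv γ (normal γ) t) (binormal γ t)

end Curves

section Surfaces

variable {M : Type*} [TopologicalSpace M] [ChartedSpace (EuclideanSpace ℝ (Fin 2)) M]

/-- The differential of `F : M → ℝ^{2,1}` at `x`, applied to a tangent vector of the surface. -/
def pushforward (F : M → R21) (x : M) (v : TangentSpace (𝓡 2) x) : R21 :=
  mfderiv (𝓡 2) 𝓘(ℝ, R21) F x v

/-- `F` is a smooth map whose differential sends nonzero tangent vectors to spacelike vectors; in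
particular it is an immersion, and it presents `M` as a spacelike hypersurface. -/
structure IsSpacelikeImmersion (F : M → R21) : Prop where
  smooth : ContMDiff (𝓡 2) 𝓘(ℝ, R21) ∞ F
  spacelike : ∀ (x : M) (v : TangentSpace (𝓡 2) x), v ≠ 0 → IsSpacelike (pushforward F x v)

/-- The norm on the tangent spaces of `M` given by the induced metric. -/
@[reducible]
def inducedENorm (F : M → R21) (x : M) : ENorm (TangentSpace (𝓡 2) x) :=
  ⟨fun v => ENNReal.ofReal √(lorentz (pushforward F x v) (pushforward F x v))⟩

/-- The Riemannian distance of the induced metric: the infimum of the lengths of the `C¹` paths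
in `M` from `x` to `y`. -/
def inducedEDist (F : M → R21) (x y : M) : ℝ≥0∞ :=
  letI : ∀ z : M, ENorm (TangentSpace (𝓡 2) z) := inducedENorm F
  Manifold.riemannianEDist (𝓡 2) x y

/-- The induced metric is complete: every sequence that is Cauchy for the induced distance
converges in `M`. (The induced distance of an immersion as above induces the topology of `M`.) -/
def IsCompleteInduced (F : M → R21) : Prop :=
  ∀ u : ℕ → M,
    (∀ ε : ℝ≥0∞, 0 < ε → ∃ n₀ : ℕ, ∀ m ≥ n₀, ∀ n ≥ n₀, inducedEDist F (u m) (u n) < ε) →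
    ∃ a : M, Filter.Tendsto u Filter.atTop (nhds a)

end Surfaces

end Minkowski

end

/-! Project along the time axis to the plane `t = 0`, identified with `ℂ`; the image is the shadow.
Dropping `-dt²` never shortens a vector, so the shadow map of a spacelike immersion is a local
diffeomorphism that does not decrease lengths. By completeness every segment lifts, and a local
homeomorphism with this property is injective (`IsSpacelikeImmersion.injective_shadow`). The surface
is therefore a graph, and the shadow of `γ` is a simple closed plane curve.

Since `T` and `N` are spacelike, orthonormal vectors, `B` is a timelike unit vector. Osculating
planes are thus never vertical, and the shadow has no inflection (`planeDet_shadow_deriv_ne_zero`).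
A simple closed plane curve without inflection is convex (`planeDet_pos_or_neg_of_simple_closed`).
Convexity follows from Hopf's argument: the direction of a chord varies continuously down to the
tangent directions, which forces the tangent to turn by exactly `2π`.

Fix a point `p` of `γ` and follow, along the vertical line through `p`, the height at which the
osculating plane at `γ t` crosses it. Up to sign this is `⟨B, γ - p⟩ / B₂`, and by `B' = τ N` its
derivative is `τ` times a determinant of the shadow, over `B₂²` (`hasDerivAt_osculating_height`).
Convexity gives the determinant a constant strict sign away from `p`. If `τ` keeps its sign, the
height is monotone over a period and takes equal values at its ends, so its derivative vanishes and
`τ = 0`. Then `B` is constant, and so is `⟨B, γ⟩`. -/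

open Set Filter Topology

/-! ### Lifting paths through local homeomorphisms -/

section Lifting

variable {M : Type*} [TopologicalSpace M] [T2Space M]

/-- A local homeomorphism from a connected Hausdorff space to a normed space is injective as soon
as the segments issuing from the image of one point lift. -/
theorem IsLocalHomeomorph.injective_of_segment_lift [ConnectedSpace M] {E : Type*}
    [NormedAddCommGroup E] [NormedSpace ℝ E] {φ : M → E}
    (hφ : IsLocalHomeomorph φ) (x₀ : M)
    (hlift : ∀ v : E, ∃ Γ : ℝ → M, Continuous Γ ∧ Γ 0 = x₀ ∧
      ∀ t ∈ Icc (0 : ℝ) 1, φ (Γ t) = φ x₀ + t • v) :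
    Function.Injective φ := by
  choose Γ hΓc hΓ0 hΓ using hlift
  let f : C(unitInterval × E, E) := ⟨fun p => φ x₀ + (p.1 : ℝ) • p.2, by fun_prop⟩
  let g : unitInterval × E → M := fun p => Γ p.2 p.1
  -- Joint continuity: the lifts depend continuously on the end point of the segment.
  have hg : Continuous g := by
    refine hφ.continuous_lift (T2Space.isSeparatedMap φ) f (funext fun p => hΓ p.2 p.1 p.1.2) ?_ ?_
    · have : (fun v => g (0, v)) = fun _ => x₀ := funext fun v => hΓ0 v
      rw [this]
      exact continuous_const
    · intro v
      exact (hΓc v).comp continuous_subtype_val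
  let σ : E → M := fun v => Γ v 1
  have hσc : Continuous σ := by
    have : Continuous fun v : E => g (1, v) := hg.comp (by fun_prop)
    simpa [g, σ] using this
  have hσ : ∀ v, φ (σ v) = φ x₀ + v := fun v => by simpa using hΓ v 1 (by simp)
  have hσl : IsLocalHomeomorph σ := by
    refine IsLocalHomeomorph.of_comp ?_ hφ hσc
    have : φ ∘ σ = Homeomorph.addLeft (φ x₀) := funext hσ
    rw [this]
    exact (Homeomorph.addLeft (φ x₀)).isLocalHomeomorph
  -- The range of the section `σ` is open because `σ` is a local homeomorphism, and closed because
  -- it is the coincidence set of two continuous maps.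
  have hrange : range σ = {x | σ (φ x - φ x₀) = x} := by
    ext x
    constructor
    · rintro ⟨v, rfl⟩
      simp [hσ]
    · intro h
      exact ⟨_, h⟩
  have huniv : range σ = univ := by
    refine IsClopen.eq_univ ⟨?_, hσl.isOpenMap.isOpen_range⟩ ⟨σ 0, 0, rfl⟩
    rw [hrange]
    exact isClosed_eq (hσc.comp (hφ.continuous.sub continuous_const)) continuous_id
  have hsec : ∀ x, σ (φ x - φ x₀) = x := fun x => by
    have : x ∈ range σ := huniv ▸ mem_univ x
    rwa [hrange] at this
  intro x y hxy
  rw [← hsec x, ← hsec y, hxy]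

/-- A path lifts through a local homeomorphism if the end points of its partial lifts converge
whenever the parameters do. -/
theorem IsLocalHomeomorph.exists_lift_of_tendsto {E : Type*} [TopologicalSpace E] [T2Space E]
    {φ : M → E} (hφ : IsLocalHomeomorph φ) (x₀ : M)
    {c : ℝ → E} (hc : Continuous c) (hx₀ : φ x₀ = c 0)
    (hlim : ∀ (u : ℕ → M) (t : ℕ → ℝ), CauchySeq t →
      (∀ m n, t m ≤ t n → ∃ Γ : ℝ → M, Continuous Γ ∧ Γ (t m) = u m ∧ Γ (t n) = u n ∧
        ∀ s ∈ Icc (t m) (t n), φ (Γ s) = c s) →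
      ∃ a, Tendsto u atTop (𝓝 a)) :
    ∃ Γ : ℝ → M, Continuous Γ ∧ Γ 0 = x₀ ∧ ∀ t ∈ Icc (0 : ℝ) 1, φ (Γ t) = c t := by
  -- Continuity method: a partial lift exists up to each `b` in `S`. The hypothesis `hlim` gives a
  -- limit point over `sSup S`, and a local inverse there continues the lift beyond it.
  let S : Set ℝ := {b | b ∈ Icc (0 : ℝ) 1 ∧ ∃ Γ : ℝ → M, Continuous Γ ∧ Γ 0 = x₀ ∧
    ∀ t ∈ Icc 0 b, φ (Γ t) = c t}
  have h0S : (0 : ℝ) ∈ S := ⟨by simp, fun _ => x₀, continuous_const, rfl, fun t ht => by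
    rw [le_antisymm ht.2 ht.1, hx₀]⟩
  have hSb : BddAbove S := ⟨1, fun b hb => hb.1.2⟩
  have hdown : ∀ b ∈ S, ∀ b', 0 ≤ b' → b' ≤ b → b' ∈ S := by
    rintro b ⟨hb, Γ, hΓ, h0, hl⟩ b' hb0 hbb
    exact ⟨⟨hb0, hbb.trans hb.2⟩, Γ, hΓ, h0, fun t ht => hl t ⟨ht.1, ht.2.trans hbb⟩⟩
  have hch : ∀ b : S, ∃ Γ : ℝ → M, Continuous Γ ∧ Γ 0 = x₀ ∧ ∀ t ∈ Icc 0 (b : ℝ), φ (Γ t) = c t :=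
    fun b => b.2.2
  choose G hGc hG0 hG using hch
  have huniq : ∀ b b' : S, (b : ℝ) ≤ b' → ∀ t ∈ Icc 0 (b : ℝ), G b t = G b' t := by
    intro b b' hbb
    have := IsSeparatedMap.eqOn_of_comp_eqOn (T2Space.isSeparatedMap φ) hφ.isLocallyInjective
      (s := Icc 0 (b : ℝ)) isPreconnected_Icc (hGc b).continuousOn (hGc b').continuousOn
      (fun t ht => by
        simp only [Function.comp_apply]
        rw [hG b t ht, hG b' t ⟨ht.1, ht.2.trans hbb⟩])
      (a := 0) ⟨le_rfl, b.2.1.1⟩ (by rw [hG0, hG0])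
    exact this
  obtain ⟨t, htm, htt, htS⟩ := exists_seq_tendsto_sSup ⟨0, h0S⟩ hSb
  set b := sSup S with hbdef
  have hb1 : b ≤ 1 := csSup_le ⟨0, h0S⟩ fun b hb => hb.1.2
  have hb0 : 0 ≤ b := le_csSup hSb h0S
  have htb : ∀ n, t n ≤ b := fun n => le_csSup hSb (htS n)
  have ht0 : ∀ n, 0 ≤ t n := fun n => (htS n).1.1
  let u : ℕ → M := fun n => G ⟨t n, htS n⟩ (t n)
  obtain ⟨a, ha⟩ := hlim u t htt.cauchySeq (fun m n hmn => by
    refine ⟨G ⟨t n, htS n⟩, hGc _, ?_, rfl, fun s hs => hG _ s ⟨(ht0 m).trans hs.1, hs.2⟩⟩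
    exact (huniq ⟨t m, htS m⟩ ⟨t n, htS n⟩ hmn (t m) ⟨ht0 m, le_rfl⟩).symm)
  have hφu : ∀ n, φ (u n) = c (t n) := fun n => hG _ _ ⟨ht0 n, le_rfl⟩
  have hφa : φ a = c b := by
    refine tendsto_nhds_unique ((hφ.continuous.tendsto a).comp ha) ?_
    simpa only [Function.comp_def, hφu] using (hc.tendsto b).comp htt
  obtain ⟨e, hae, rfl⟩ := hφ a
  have hnhds : c ⁻¹' e.target ∈ 𝓝 b := by
    apply hc.continuousAt.preimage_mem_nhds
    rw [← hφa]
    exact e.open_target.mem_nhds (e.map_source hae)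
  obtain ⟨δ, hδ, hball⟩ := Metric.mem_nhds_iff.1 hnhds
  obtain ⟨n, hnδ, hne⟩ := ((htt.eventually (Ioi_mem_nhds (sub_lt_self b hδ))).and
    (ha.eventually (e.open_source.mem_nhds hae))).exists
  set b' := b + δ / 2 with hb'
  have hmem : ∀ s ∈ Icc (t n) b', c s ∈ e.target := by
    intro s hs
    apply hball
    rw [Metric.mem_ball, Real.dist_eq, abs_lt]
    have := hs.1; have := hs.2; have : b - δ < t n := hnδ
    constructor <;> linarith
  have htb' : t n ≤ b' := (htb n).trans (by linarith)
  -- Clamping the parameter keeps `c` inside the target of `e`, so that the extended lift is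
  -- continuous on all of `ℝ`.
  let cl : ℝ → ℝ := fun s => max (t n) (min s b')
  have hclmem : ∀ s, cl s ∈ Icc (t n) b' :=
    fun s => ⟨le_max_left _ _, max_le htb' (min_le_right _ _)⟩
  let Γ : ℝ → M := fun s => if s ≤ t n then G ⟨t n, htS n⟩ s else e.symm (c (cl s))
  have hΓc : Continuous Γ := by
    refine Continuous.if_le (hGc _) ?_ continuous_id continuous_const ?_
    · refine e.continuousOn_symm.comp_continuous (hc.comp ?_) fun s => hmem _ (hclmem s)
      exact continuous_const.max (continuous_id.min continuous_const)
    · intro s hs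
      have : cl s = t n := by simp [cl, hs, htb']
      rw [this, hs, ← hφu n, e.left_inv hne]
  have hΓl : ∀ s ∈ Icc 0 b', e (Γ s) = c s := by
    intro s hs
    by_cases h : s ≤ t n
    · simp only [Γ, if_pos h]
      exact hG _ s ⟨hs.1, h⟩
    · have : cl s = s := by simp [cl, hs.2, le_of_not_ge h]
      simp only [Γ, if_neg h, this]
      exact e.right_inv (hmem s ⟨le_of_not_ge h, hs.2⟩)
  have hΓ0 : Γ 0 = x₀ := by simp only [Γ, if_pos (ht0 n), hG0]
  have hS : min b' 1 ∈ S := by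
    refine ⟨⟨le_min (by linarith) zero_le_one, min_le_right _ _⟩, Γ, hΓc, hΓ0, fun s hs => ?_⟩
    exact hΓl s ⟨hs.1, hs.2.trans (min_le_left _ _)⟩
  have h1 : 1 ≤ b' := by
    by_contra h
    have := le_csSup hSb hS
    rw [min_eq_left (le_of_not_ge h)] at this
    linarith
  exact ⟨Γ, hΓc, hΓ0, fun s hs => hΓl s ⟨hs.1, hs.2.trans h1⟩⟩

end Lifting

/-! ### Inverse function theorem on a manifold -/

section InverseFunction

variable {n : ℕ} {M : Type*} [TopologicalSpace M] [ChartedSpace (EuclideanSpace ℝ (Fin n)) M]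
  [IsManifold (𝓡 n) ∞ M] {E : Type*} [NormedAddCommGroup E] [NormedSpace ℝ E]
  [FiniteDimensional ℝ E]

/-- The inverse function theorem on a manifold, for a map to a vector space. -/
theorem ContMDiff.exists_smooth_local_inverse {φ : M → E}
    (hφ : ContMDiff (𝓡 n) 𝓘(ℝ, E) ∞ φ) (hdim : Module.finrank ℝ E = n) (x : M)
    (hinj : ∀ v : TangentSpace (𝓡 n) x, mfderiv (𝓡 n) 𝓘(ℝ, E) φ x v = 0 → v = 0) :
    ∃ e : OpenPartialHomeomorph M E, x ∈ e.source ∧ EqOn φ e e.source ∧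
      ContMDiffAt 𝓘(ℝ, E) (𝓡 n) ∞ e.symm (φ x) := by
  set c := chartAt (EuclideanSpace ℝ (Fin n)) x with hc
  have hxc : x ∈ c.source := mem_chart_source _ x
  let g : EuclideanSpace ℝ (Fin n) → E := φ ∘ c.symm
  have hg : ContDiffAt ℝ ∞ g (c x) := by
    have := (contMDiffAt_iff (I := 𝓡 n) (I' := 𝓘(ℝ, E))).1 (hφ x)
    simpa [g, Function.comp_def, contDiffWithinAt_univ, chartAt_self_eq] using this.2
  have hd : ∀ v, fderiv ℝ g (c x) v = mfderiv (𝓡 n) 𝓘(ℝ, E) φ x v := by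
    intro v
    rw [(hφ.mdifferentiable (by simp) x).mfderiv]
    simp [g, writtenInExtChartAt, Function.comp_def, fderivWithin_univ, chartAt_self_eq, hc]
    rfl
  have hinj' : Function.Injective (fderiv ℝ g (c x)) :=
    (injective_iff_map_eq_zero _).2 fun v hv => hinj v ((hd v).symm.trans hv)
  let L : EuclideanSpace ℝ (Fin n) ≃L[ℝ] E :=
    (LinearEquiv.ofInjectiveOfFinrankEq (fderiv ℝ g (c x)).toLinearMap hinj'
      (by simp [hdim])).toContinuousLinearEquiv
  have hL : HasFDerivAt g (L : EuclideanSpace ℝ (Fin n) →L[ℝ] E) (c x) := by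
    have h := (hg.differentiableAt (by simp)).hasFDerivAt
    have : (L : EuclideanSpace ℝ (Fin n) →L[ℝ] E) = fderiv ℝ g (c x) := by
      ext v; rfl
    rwa [this]
  let h := hg.toOpenPartialHomeomorph g hL (by simp)
  have hgx : g (c x) = φ x := by simp [g, hxc]
  refine ⟨c.trans h, ?_, ?_, ?_⟩
  · rw [OpenPartialHomeomorph.trans_source]
    exact ⟨hxc, hg.mem_toOpenPartialHomeomorph_source hL (by simp)⟩
  · intro y hy
    rw [OpenPartialHomeomorph.trans_source] at hy
    simp [h, g, c.left_inv hy.1]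
  · have h1 : ContMDiffAt 𝓘(ℝ, E) (𝓡 n) ∞ h.symm (g (c x)) :=
      (hg.to_localInverse hL (by simp)).contMDiffAt
    have h2 : h.symm (g (c x)) = c x := hg.localInverse_apply_image hL (by simp)
    have h3 : ContMDiffAt (𝓡 n) (𝓡 n) ∞ c.symm (c x) :=
      (contMDiffOn_chart_symm (c x) (c.map_source hxc)).contMDiffAt
        (c.open_target.mem_nhds (c.map_source hxc))
    rw [← hgx]
    rw [← h2] at h3
    exact h3.comp _ h1

end InverseFunction

/-! ### Complete spacelike surfaces are graphs -/

namespace Minkowski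

/-- The projection of `ℝ^{2,1}` along the time axis onto the spacelike plane `t = 0`, which is
identified with `ℂ`. -/
noncomputable def shadow : R21 →L[ℝ] ℂ :=
  (EuclideanSpace.proj 0 : R21 →L[ℝ] ℝ).smulRight 1 +
    (EuclideanSpace.proj 1 : R21 →L[ℝ] ℝ).smulRight Complex.I

@[simp] theorem shadow_re (v : R21) : (shadow v).re = v 0 := by simp [shadow]

@[simp] theorem shadow_im (v : R21) : (shadow v).im = v 1 := by simp [shadow]

/-- The two sides differ by the square of the time component. This bounds the induced length of a
path by the Euclidean length of its shadow. -/
theorem lorentz_le_norm_shadow_sq (v : R21) : lorentz v v ≤ ‖shadow v‖ ^ 2 := by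
  rw [← Complex.normSq_eq_norm_sq, Complex.normSq_apply, shadow_re, shadow_im, lorentz]
  nlinarith [mul_self_nonneg (v 2)]

theorem IsSpacelike.shadow_ne_zero {v : R21} (hv : IsSpacelike v) : shadow v ≠ 0 := by
  intro h
  have := lorentz_le_norm_shadow_sq v
  rw [h, norm_zero] at this
  have h' : 0 < lorentz v v := hv
  linarith

theorem lorentz_smul_smul (c : ℝ) (v : R21) : lorentz (c • v) (c • v) = c ^ 2 * lorentz v v := by
  simp [lorentz]; ring

variable {M : Type*} [TopologicalSpace M] [ChartedSpace (EuclideanSpace ℝ (Fin 2)) M] {F : M → R21}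

theorem IsSpacelikeImmersion.contMDiff_shadow (hF : IsSpacelikeImmersion F) :
    ContMDiff (𝓡 2) 𝓘(ℝ, ℂ) ∞ (shadow ∘ F) :=
  shadow.contMDiff.comp hF.smooth

theorem IsSpacelikeImmersion.mfderiv_shadow (hF : IsSpacelikeImmersion F) (x : M)
    (v : TangentSpace (𝓡 2) x) :
    mfderiv (𝓡 2) 𝓘(ℝ, ℂ) (shadow ∘ F) x v = shadow (pushforward F x v) := by
  have h1 := (hF.smooth.mdifferentiable (by simp) x).hasMFDerivAt
  have h2 := (shadow.hasMFDerivAt (x := F x)).comp x h1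
  rw [h2.mfderiv]
  rfl

/-- The kernel of `shadow` is the time axis, which contains no spacelike vector, so the differential
of `shadow ∘ F` is injective between spaces of dimension two. -/
theorem IsSpacelikeImmersion.exists_local_inverse [IsManifold (𝓡 2) ∞ M]
    (hF : IsSpacelikeImmersion F) (x : M) :
    ∃ e : OpenPartialHomeomorph M ℂ, x ∈ e.source ∧ EqOn (shadow ∘ F) e e.source ∧
      ContMDiffAt 𝓘(ℝ, ℂ) (𝓡 2) ∞ e.symm ((shadow ∘ F) x) := by
  refine hF.contMDiff_shadow.exists_smooth_local_inverse Complex.finrank_real_complex x ?_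
  intro v hv
  by_contra hv0
  rw [hF.mfderiv_shadow] at hv
  exact (hF.spacelike x v hv0).shadow_ne_zero hv

/-- Homogeneity of the induced norm, on which the general facts about path length and Riemannian
distance rely. -/
theorem enormSMulClass_inducedENorm (F : M → R21) (z : M) :
    letI := inducedENorm F z
    ENormSMulClass ℝ (TangentSpace (𝓡 2) z) := by
  let _ := inducedENorm F z
  refine ⟨fun r w => ?_⟩
  change ENNReal.ofReal √(lorentz (pushforward F z (r • w)) (pushforward F z (r • w))) =
    ‖r‖ₑ * ENNReal.ofReal √(lorentz (pushforward F z w) (pushforward F z w))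
  have : pushforward F z (r • w) = r • pushforward F z w :=
    (mfderiv (𝓡 2) 𝓘(ℝ, R21) F z).map_smul r w
  rw [this, lorentz_smul_smul, Real.sqrt_mul (sq_nonneg r), Real.sqrt_sq_eq_abs,
    ENNReal.ofReal_mul (abs_nonneg r), Real.enorm_eq_ofReal_abs]

theorem inducedEDist_comm (F : M → R21) (x y : M) : inducedEDist F x y = inducedEDist F y x := by
  let _ : ∀ z : M, ENorm (TangentSpace (𝓡 2) z) := inducedENorm F
  have := enormSMulClass_inducedENorm F
  exact Manifold.riemannianEDist_comm

/-- A continuous lift of a segment of velocity `v` has length at most `‖v‖` times the length of the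
parameter interval. -/
theorem IsSpacelikeImmersion.inducedEDist_lift_le [IsManifold (𝓡 2) ∞ M]
    (hF : IsSpacelikeImmersion F) {Γ : ℝ → M} (hΓ : Continuous Γ) {p v : ℂ} {a b : ℝ} (hab : a ≤ b)
    (hlift : ∀ s ∈ Icc a b, shadow (F (Γ s)) = p + s • v) :
    inducedEDist F (Γ a) (Γ b) ≤ ENNReal.ofReal (‖v‖ * (b - a)) := by
  -- A merely continuous lift is smooth, since near each parameter it is a smooth local inverse
  -- applied to the segment.
  have hsm : ContMDiffOn 𝓘(ℝ, ℝ) (𝓡 2) 1 Γ (Icc a b) := by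
    intro t ht
    obtain ⟨e, hx, he, hsymm⟩ := hF.exists_local_inverse (Γ t)
    have hc : ContMDiffAt 𝓘(ℝ, ℝ) 𝓘(ℝ, ℂ) ∞ (fun s : ℝ => p + s • v) t := by
      apply ContDiffAt.contMDiffAt
      fun_prop
    have hlt : (shadow ∘ F) (Γ t) = p + t • v := hlift t ht
    rw [hlt] at hsymm
    have hcomp : ContMDiffAt 𝓘(ℝ, ℝ) (𝓡 2) ∞ (e.symm ∘ fun s : ℝ => p + s • v) t :=
      hsymm.comp t hc
    have hcomp1 := (hcomp.of_le (m := 1) (by simp)).contMDiffWithinAt (s := Icc a b)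
    refine hcomp1.congr_of_eventuallyEq_of_mem ?_ ht
    filter_upwards [self_mem_nhdsWithin,
      mem_nhdsWithin_of_mem_nhds (hΓ.continuousAt.preimage_mem_nhds (e.open_source.mem_nhds hx))]
      with s hs hse
    have : e (Γ s) = p + s • v := by rw [← he hse, ← hlift s hs]; rfl
    simp only [Function.comp_apply, ← this]
    exact (e.left_inv hse).symm
  let _ : ∀ z : M, ENorm (TangentSpace (𝓡 2) z) := inducedENorm F
  have := enormSMulClass_inducedENorm F
  refine (Manifold.riemannianEDist_le_pathELength hsm rfl rfl hab).trans ?_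
  rw [Manifold.pathELength_eq_lintegral_mfderiv_Ioo]
  have hbound : ∀ t ∈ Ioo a b, ‖mfderiv 𝓘(ℝ, ℝ) (𝓡 2) Γ t 1‖ₑ ≤ ENNReal.ofReal ‖v‖ := by
    intro t ht
    have hd : MDifferentiableAt 𝓘(ℝ, ℝ) (𝓡 2) Γ t :=
      ((hsm t ⟨ht.1.le, ht.2.le⟩).contMDiffAt (Icc_mem_nhds ht.1 ht.2)).mdifferentiableAt (by simp)
    have hd2 := ((hF.contMDiff_shadow.mdifferentiable (by simp) (Γ t)).hasMFDerivAt).comp t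
      hd.hasMFDerivAt
    have hc : HasDerivAt (fun s : ℝ => p + s • v) v t := by
      simpa using ((hasDerivAt_id t).smul_const v).const_add p
    have hd3 := hc.hasFDerivAt.hasMFDerivAt.congr_of_eventuallyEq
      (f₁ := (shadow ∘ F) ∘ Γ) (by
        filter_upwards [Icc_mem_nhds ht.1 ht.2] with s hs using hlift s hs)
    have heq := hasMFDerivAt_unique hd2 hd3
    have hv : mfderiv (𝓡 2) 𝓘(ℝ, ℂ) (shadow ∘ F) (Γ t) (mfderiv 𝓘(ℝ, ℝ) (𝓡 2) Γ t 1) = v := by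
      have := congrArg (fun A => A 1) heq
      exact this.trans (one_smul ℝ v)
    rw [hF.mfderiv_shadow] at hv
    refine ENNReal.ofReal_le_ofReal ?_
    rw [← hv]
    exact Real.sqrt_le_iff.2 ⟨norm_nonneg _, lorentz_le_norm_shadow_sq _⟩
  refine (MeasureTheory.setLIntegral_mono measurable_const hbound).trans ?_
  rw [MeasureTheory.setLIntegral_const, Real.volume_Ioo, ENNReal.ofReal_mul (norm_nonneg v)]

/-- A complete spacelike hypersurface is a graph over the plane `t = 0`. -/
theorem IsSpacelikeImmersion.injective_shadow [T2Space M] [ConnectedSpace M]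
    [IsManifold (𝓡 2) ∞ M] (hF : IsSpacelikeImmersion F) (hcomplete : IsCompleteInduced F) :
    Function.Injective (shadow ∘ F) := by
  have hloc : IsLocalHomeomorph (shadow ∘ F) := IsLocalHomeomorph.mk _ fun x => by
    obtain ⟨e, hx, he, -⟩ := hF.exists_local_inverse x
    exact ⟨e, hx, he⟩
  obtain ⟨x₀⟩ := (inferInstance : Nonempty M)
  refine hloc.injective_of_segment_lift x₀ fun v => ?_
  refine hloc.exists_lift_of_tendsto x₀ (c := fun t : ℝ => (shadow ∘ F) x₀ + t • v) (by fun_prop)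
    (by simp) fun u t ht hlift => ?_
  refine hcomplete u fun ε hε => ?_
  have hle : ∀ m n, t m ≤ t n → inducedEDist F (u m) (u n) ≤ ENNReal.ofReal (‖v‖ * |t n - t m|) := by
    intro m n hmn
    obtain ⟨Γ, hΓ, h1, h2, h3⟩ := hlift m n hmn
    rw [← h1, ← h2, abs_of_nonneg (sub_nonneg.2 hmn)]
    exact hF.inducedEDist_lift_le hΓ hmn h3
  have hle' : ∀ m n, inducedEDist F (u m) (u n) ≤ ENNReal.ofReal (‖v‖ * |t n - t m|) := by
    intro m n
    rcases le_total (t m) (t n) with h | h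
    · exact hle m n h
    · rw [inducedEDist_comm, abs_sub_comm]
      exact hle n m h
  obtain ⟨ε', hε', hε'ε⟩ := ENNReal.lt_iff_exists_nnreal_btwn.1 hε
  have hε'' : (0 : ℝ) < ε' := by simpa using hε'
  -- The `+ 1` covers the case `v = 0`.
  obtain ⟨n₀, hn₀⟩ := Metric.cauchySeq_iff.1 ht (ε' / (‖v‖ + 1)) (by positivity)
  refine ⟨n₀, fun m hm n hn => ((hle' m n).trans ?_).trans_lt hε'ε⟩
  rw [← ENNReal.ofReal_coe_nnreal]
  refine ENNReal.ofReal_le_ofReal ?_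
  have h := hn₀ n hn m hm
  rw [Real.dist_eq, lt_div_iff₀ (by positivity)] at h
  nlinarith [abs_nonneg (t n - t m), norm_nonneg v]

end Minkowski

/-! ### Convexity of simple closed plane curves -/

section PlaneCurves

/-- The determinant of two vectors of the oriented plane `ℂ`. -/
def planeDet (a b : ℂ) : ℝ := a.re * b.im - a.im * b.re

theorem planeDet_exp (a b : ℂ) :
    planeDet (Complex.exp a) (Complex.exp b) =
      Real.exp a.re * Real.exp b.re * Real.sin (b.im - a.im) := by
  simp only [planeDet, Complex.exp_re, Complex.exp_im, Real.sin_sub]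
  ring

theorem planeDet_eq_im_div (a b : ℂ) : planeDet a b = ‖a‖ ^ 2 * (b / a).im := by
  rcases eq_or_ne a 0 with rfl | ha
  · simp [planeDet]
  · have : Complex.normSq a ≠ 0 := by simpa using ha
    rw [Complex.div_im, ← Complex.normSq_eq_norm_sq, planeDet]
    field_simp

theorem Function.Periodic.ne_of_injOn_Ico {X : Type*} {f : ℝ → X} {L : ℝ}
    (hf : Function.Periodic f L) (hL : 0 < L) (hinj : InjOn f (Ico 0 L)) {s t : ℝ}
    (hst : s < t) (hts : t < s + L) : f s ≠ f t := by
  intro h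
  have hmod : ∀ x, f (toIcoMod hL 0 x) = f x := fun x => by
    rw [toIcoMod, hf.sub_zsmul_eq]
  have hmem : ∀ x, toIcoMod hL 0 x ∈ Ico 0 L := fun x => by
    simpa using toIcoMod_mem_Ico hL 0 x
  have heq := hinj (hmem s) (hmem t) (by rw [hmod, hmod, h])
  obtain ⟨n, hn⟩ := (toIcoMod_eq_toIcoMod hL).1 heq
  rw [zsmul_eq_mul] at hn
  have h1 : (0 : ℝ) < n := by
    by_contra hcon
    nlinarith
  have h2 : (n : ℝ) < 1 := by
    by_contra hcon
    nlinarith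
  have h1' : 0 < n := by exact_mod_cast h1
  have h2' : n < 1 := by exact_mod_cast h2
  omega

/-- The mean velocity of a curve between two parameters. -/
noncomputable def meanVelocity (α : ℝ → ℂ) (s t : ℝ) : ℂ :=
  ∫ x in (0 : ℝ)..1, deriv α (s + x * (t - s))

section

variable {α : ℝ → ℂ}

theorem meanVelocity_self (s : ℝ) : meanVelocity α s s = deriv α s := by simp [meanVelocity]

theorem meanVelocity_comm (s t : ℝ) : meanVelocity α s t = meanVelocity α t s := by
  have h := intervalIntegral.integral_comp_sub_left
    (fun x : ℝ => deriv α (t + x * (s - t))) (a := 0) (b := 1) 1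
  simp only [sub_self, sub_zero] at h
  rw [meanVelocity, meanVelocity, ← h]
  congr 1
  ext x
  congr 1
  ring

theorem meanVelocity_add_period {L : ℝ} (hper : Function.Periodic α L) (s t : ℝ) :
    meanVelocity α (s + L) (t + L) = meanVelocity α s t := by
  have hd : Function.Periodic (deriv α) L := fun x => by
    rw [← deriv_comp_add_const]
    exact congrArg (fun f => deriv f x) (funext hper)
  rw [meanVelocity, meanVelocity]
  congr 1
  ext x
  rw [← hd (s + x * (t - s))]
  congr 1
  ring

variable (hα : ContDiff ℝ 1 α)
include hα

theorem smul_meanVelocity (s t : ℝ) : (t - s) • meanVelocity α s t = α t - α s := by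
  have hd : Continuous (deriv α) := hα.continuous_deriv le_rfl
  have h := intervalIntegral.integral_unitInterval_deriv_eq_sub (𝕜 := ℝ) (f := α) (f' := deriv α)
    (z₀ := s) (z₁ := t - s) (by fun_prop)
    (fun x _ => (hα.differentiable (by simp) _).hasDerivAt)
  simpa [meanVelocity] using h

theorem continuous_meanVelocity : Continuous fun p : ℝ × ℝ => meanVelocity α p.1 p.2 := by
  have hd : Continuous (deriv α) := hα.continuous_deriv le_rfl
  refine intervalIntegral.continuous_parametric_intervalIntegral_of_continuous' ?_ 0 1
  simp only [Function.uncurry_def]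
  fun_prop

end

/-- The direction of the chord of an `L`-periodic curve from `s` to `s + r L`, extended
continuously to the tangent directions for `r = 0` and `r = 1`. -/
noncomputable def chordDirection (α : ℝ → ℂ) (L s r : ℝ) : ℂ :=
  meanVelocity α s (s + r * L) - meanVelocity α (s + L) (s + r * L)

section

variable {α : ℝ → ℂ} {L : ℝ} (hα : ContDiff ℝ 1 α) (hper : Function.Periodic α L)

include hper in
-- The same chord seen from its other end. This symmetry relates the two halves of the turning of
-- the tangent.
theorem chordDirection_reverse (s r : ℝ) :
    chordDirection α L (s + r * L) (1 - r) = -chordDirection α L s r := by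
  have h : s + r * L + (1 - r) * L = s + L := by ring
  rw [chordDirection, chordDirection, h, meanVelocity_add_period hper, neg_sub,
    meanVelocity_comm (s + r * L), meanVelocity_comm (s + r * L)]

include hα hper

/-- Since `1 / r + 1 / (1 - r) = 1 / (r (1 - r))`, the difference of the two mean velocities is the
chord divided by `r (1 - r) L`, a positive factor for `0 < r < 1`. -/
theorem smul_chordDirection (s r : ℝ) :
    (r * (1 - r) * L) • chordDirection α L s r = α (s + r * L) - α s := by
  have h1 := smul_meanVelocity hα s (s + r * L)
  have h2 := smul_meanVelocity hα (s + L) (s + r * L)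
  rw [hper s] at h2
  rw [chordDirection]
  simp only [Complex.real_smul] at *
  push_cast at *
  linear_combination (1 - (r : ℂ)) * h1 + (r : ℂ) * h2

theorem chordDirection_zero (hL : L ≠ 0) (s : ℝ) : chordDirection α L s 0 = deriv α s := by
  have h2 := smul_meanVelocity hα (s + L) s
  rw [hper s, sub_self] at h2
  have : meanVelocity α (s + L) s = 0 := by simpa [hL] using h2
  simp [chordDirection, this, meanVelocity_self]

theorem chordDirection_one (hL : L ≠ 0) (s : ℝ) : chordDirection α L s 1 = -deriv α s := by
  have h := chordDirection_reverse hper s 0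
  simpa [chordDirection_zero hα hper hL] using h

theorem chordDirection_ne_zero (hL : 0 < L) (hinj : InjOn α (Ico 0 L))
    (hreg : ∀ t, deriv α t ≠ 0) (s : ℝ) {r : ℝ} (hr : r ∈ Icc (0 : ℝ) 1) :
    chordDirection α L s r ≠ 0 := by
  rcases hr.1.eq_or_lt with rfl | h0
  · rw [chordDirection_zero hα hper hL.ne']
    exact hreg s
  rcases hr.2.eq_or_lt with rfl | h1
  · rw [chordDirection_one hα hper hL.ne']
    exact neg_ne_zero.2 (hreg s)
  intro h
  have := smul_chordDirection hα hper s r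
  rw [h, smul_zero] at this
  refine hper.ne_of_injOn_Ico hL hinj (s := s) (t := s + r * L) ?_ ?_ (sub_eq_zero.1 this.symm).symm
  · nlinarith
  · nlinarith

end

/-- `exp` is locally injective, so a continuous map into one of its fibres is constant on a
connected space. -/
theorem continuous_eq_of_exp_eq {X : Type*} [TopologicalSpace X] [PreconnectedSpace X] {δ : X → ℂ}
    (hδ : Continuous δ) {c : ℂ} (h : ∀ x, Complex.exp (δ x) = c) (x y : X) : δ x = δ y := by
  refine (T2Space.isSeparatedMap
    fun z : ℂ => (⟨_, z.exp_ne_zero⟩ : {z : ℂ // z ≠ 0})).const_of_comp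
    Complex.isCoveringMap_exp.isLocalHomeomorph.isLocallyInjective hδ ?_ x y
  intro a b
  simp [h]

/-- A continuous logarithm of a differentiable curve is differentiable. -/
theorem hasDerivAt_of_exp_eq {f Λ : ℝ → ℂ} (hΛ : Continuous Λ) (h : ∀ t, Complex.exp (Λ t) = f t)
    {f' : ℂ} {t : ℝ} (hf : HasDerivAt f f' t) : HasDerivAt Λ (f' / f t) t := by
  have hft : f t ≠ 0 := by rw [← h]; exact Complex.exp_ne_zero _
  -- Near `t` the imaginary part of `Λ s - Λ t` stays in `(-π, π)`, so `Λ` agrees there with this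
  -- principal branch.
  have hlog : HasDerivAt (fun s => Λ t + Complex.log (f s / f t)) (f' / f t) t := by
    have h1 := (hf.div_const (f t)).clog_real (by simp [hft])
    simpa [hft] using h1.const_add (Λ t)
  refine hlog.congr_of_eventuallyEq ?_
  have him : Tendsto (fun s => (Λ s - Λ t).im) (𝓝 t) (𝓝 0) := by
    have : Continuous fun s => (Λ s - Λ t).im := by fun_prop
    simpa using this.tendsto t
  filter_upwards [him.eventually (Ioo_mem_nhds (neg_lt_zero.2 Real.pi_pos) Real.pi_pos)] with s hs
  rw [← h s, ← h t, ← Complex.exp_sub, Complex.log_exp hs.1 hs.2.le]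
  ring

/-- A simple closed plane curve of positive curvature is convex: it lies to the left of each of its
tangents. -/
theorem planeDet_pos_of_simple_closed {α : ℝ → ℂ} {L : ℝ} (hL : 0 < L) (hα : ContDiff ℝ 2 α)
    (hper : Function.Periodic α L) (hinj : InjOn α (Ico 0 L))
    (hcurv : ∀ t, 0 < planeDet (deriv α t) (deriv (deriv α) t)) {t s : ℝ} (hts : t < s)
    (hsL : s < t + L) : 0 < planeDet (deriv α t) (α s - α t) := by
  have hα1 : ContDiff ℝ 1 α := hα.of_le (by norm_num)
  have hdiff : ∀ t, HasDerivAt α (deriv α t) t := fun t =>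
    (hα1.differentiable (by simp) t).hasDerivAt
  have hdiff2 : ∀ t, HasDerivAt (deriv α) (deriv (deriv α) t) t := fun t =>
    ((hα.differentiable_deriv_two) t).hasDerivAt
  have hreg : ∀ t, deriv α t ≠ 0 := fun t h => by
    have := hcurv t
    simp [h, planeDet] at this
  -- Clamping `r` to `[0, 1]` makes the chord direction a nowhere zero function on the whole plane,
  -- which is simply connected, so it has a continuous logarithm `Λ`.
  let cl : ℝ → ℝ := fun r => max 0 (min 1 r)
  have hclc : Continuous cl := by fun_prop
  have hcl : ∀ r, cl r ∈ Icc (0 : ℝ) 1 :=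
    fun r => ⟨le_max_left _ _, max_le zero_le_one (min_le_left _ _)⟩
  have hclid : ∀ r ∈ Icc (0 : ℝ) 1, cl r = r := fun r hr => by simp [cl, hr.1, hr.2]
  let V : ℝ × ℝ → ℂ := fun p => chordDirection α L p.1 (cl p.2)
  have hVc : Continuous V := by
    have := continuous_meanVelocity hα1
    simp only [V, chordDirection]
    refine (this.comp (f := fun p : ℝ × ℝ => (p.1, p.1 + cl p.2 * L)) (by fun_prop)).sub
      (this.comp (f := fun p : ℝ × ℝ => (p.1 + L, p.1 + cl p.2 * L)) (by fun_prop))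
  have hV0 : ∀ p, V p ≠ 0 := fun p => chordDirection_ne_zero hα1 hper hL hinj hreg p.1 (hcl p.2)
  obtain ⟨Λ, hΛc, hΛ⟩ : ∃ Λ : ℝ × ℝ → ℂ, Continuous Λ ∧ ∀ p, Complex.exp (Λ p) = V p := by
    obtain ⟨F, ⟨-, hF⟩, -⟩ := Complex.isCoveringMapOn_exp.existsUnique_continuousMap_lifts
      ⟨V, hVc⟩ (a₀ := 0) (Complex.exp_log (hV0 0)) hV0
    exact ⟨F, F.continuous, fun p => congrFun hF p⟩
  -- Reversing a chord changes `Λ` by a logarithm of `-1`, which is constant by continuity. Its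
  -- value `K` is read off at `r = 0` and `r = 1`: the tangent turns by `2 * K.im` over a period.
  have hreverse : ∀ p q : ℝ × ℝ, Λ (p.1 + cl p.2 * L, 1 - cl p.2) - Λ (p.1, cl p.2) =
      Λ (q.1 + cl q.2 * L, 1 - cl q.2) - Λ (q.1, cl q.2) := by
    refine continuous_eq_of_exp_eq (c := -1)
      (δ := fun p : ℝ × ℝ => Λ (p.1 + cl p.2 * L, 1 - cl p.2) - Λ (p.1, cl p.2)) (by fun_prop) ?_
    intro p
    have h1 : cl (1 - cl p.2) = 1 - cl p.2 :=
      hclid _ ⟨by linarith [(hcl p.2).2], by linarith [(hcl p.2).1]⟩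
    rw [Complex.exp_sub, hΛ, hΛ]
    simp only [V, h1, hclid _ (hcl p.2), chordDirection_reverse hper]
    exact neg_div_self (chordDirection_ne_zero hα1 hper hL hinj hreg p.1 (hcl p.2))
  set K : ℂ := Λ (0, 1) - Λ (0, 0) with hK
  have hcl0 : cl 0 = 0 := by simp [cl]
  have hcl1 : cl 1 = 1 := by simp [cl]
  have hK0 : ∀ s, Λ (s, 1) - Λ (s, 0) = K := fun s => by
    simpa [hcl0] using hreverse (s, 0) (0, 0)
  have hK1 : ∀ s, Λ (s + L, 0) - Λ (s, 1) = K := fun s => by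
    simpa [hcl0, hcl1] using hreverse (s, 1) (0, 0)
  have hV00 : ∀ s, V (s, 0) = deriv α s := fun s => by
    simp only [V, hcl0, chordDirection_zero hα1 hper hL.ne']
  have hV1 : ∀ s, V (s, 1) = -deriv α s := fun s => by
    simp only [V, hcl1, chordDirection_one hα1 hper hL.ne']
  have hexpK : Complex.exp K = -1 := by
    rw [hK, Complex.exp_sub, hΛ, hΛ, hV1, hV00, neg_div_self (hreg 0)]
  set θ : ℝ → ℝ := fun s => (Λ (s, 0)).im with hθ
  have hθL : ∀ s, θ (s + L) = θ s + 2 * K.im := fun s => by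
    have h0 := congrArg Complex.im (hK0 s)
    have h1 := congrArg Complex.im (hK1 s)
    simp only [Complex.sub_im] at h0 h1
    simp only [hθ]
    linarith
  have hθmono : StrictMono θ := by
    refine strictMono_of_deriv_pos fun t => ?_
    have h : HasDerivAt (fun s => Λ (s, 0)) (deriv (deriv α) t / deriv α t) t :=
      hasDerivAt_of_exp_eq (f := deriv α) (by fun_prop) (fun s => by rw [hΛ, hV00]) (hdiff2 t)
    have h' : HasDerivAt θ (deriv (deriv α) t / deriv α t).im t :=
      (Complex.imCLM.hasFDerivAt.comp_hasDerivAt t h)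
    rw [h'.deriv]
    have h3 := hcurv t
    rw [planeDet_eq_im_div] at h3
    exact pos_of_mul_pos_right h3 (sq_nonneg _)
  have hKpos : 0 < K.im := by
    have := hθmono (show (0 : ℝ) < 0 + L by linarith)
    rw [hθL] at this
    linarith
  -- From a lowest point every chord direction has nonnegative imaginary part. If `K.im ≥ 2π`, the
  -- arguments of these directions would sweep a full turn and one of them would point straight
  -- down.
  have hKlt : K.im < 2 * Real.pi := by
    by_contra hcon
    push Not at hcon
    obtain ⟨s₀, hs₀⟩ : ∃ s₀, ∀ s, (α s₀).im ≤ (α s).im := by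
      have hc : Continuous fun s => (α s).im := Complex.continuous_im.comp hα.continuous
      obtain ⟨s₀, -, h⟩ := isCompact_Icc.exists_isMinOn (nonempty_Icc.2 hL.le) hc.continuousOn
      refine ⟨s₀, fun s => ?_⟩
      obtain ⟨y, hy, hys⟩ := hper.exists_mem_Ico₀ hL s
      rw [hys]
      exact h (Ico_subset_Icc_self hy)
    have him0 : (deriv α s₀).im = 0 := by
      have h1 : HasDerivAt (fun s => (α s).im) (deriv α s₀).im s₀ :=
        Complex.imCLM.hasFDerivAt.comp_hasDerivAt s₀ (hdiff s₀)
      exact IsLocalMin.hasDerivAt_eq_zero (Filter.Eventually.of_forall hs₀) h1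
    have hVim : ∀ r ∈ Icc (0 : ℝ) 1, 0 ≤ (V (s₀, r)).im := by
      intro r hr
      rcases hr.1.eq_or_lt with rfl | h0
      · rw [hV00, him0]
      rcases hr.2.eq_or_lt with rfl | h1
      · rw [hV1, Complex.neg_im, him0, neg_zero]
      have h2 := congrArg Complex.im (smul_chordDirection hα1 hper s₀ r)
      rw [Complex.smul_im, Complex.sub_im, smul_eq_mul] at h2
      have h3 : 0 < r * (1 - r) * L := mul_pos (mul_pos h0 (sub_pos.2 h1)) hL
      simp only [V, hclid r hr]
      refine nonneg_of_mul_nonneg_right (a := r * (1 - r) * L) ?_ h3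
      rw [h2]
      linarith [hs₀ (s₀ + r * L)]
    obtain ⟨k, hk, -⟩ := existsUnique_add_zsmul_mem_Ico Real.two_pi_pos (-(Real.pi / 2)) (θ s₀)
    have hend : (Λ (s₀, 1)).im = θ s₀ + K.im := by
      have h0 := congrArg Complex.im (hK0 s₀)
      simp only [Complex.sub_im] at h0
      simp only [hθ]
      linarith
    have hcont : ContinuousOn (fun r => (Λ (s₀, r)).im) (Icc 0 1) := by fun_prop
    obtain ⟨r, hr, hrk⟩ := intermediate_value_Icc zero_le_one hcont
      (show -(Real.pi / 2) + k • (2 * Real.pi) ∈ Icc (Λ (s₀, 0)).im (Λ (s₀, 1)).im from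
        ⟨hk.1, by rw [hend]; linarith [hk.2]⟩)
    have h4 := hVim r hr
    simp only at hrk
    rw [← hΛ, Complex.exp_im, hrk, zsmul_eq_mul, Real.sin_add_int_mul_two_pi, Real.sin_neg,
      Real.sin_pi_div_two] at h4
    linarith [Real.exp_pos (Λ (s₀, r)).re]
  have hKpi : K.im = Real.pi := by
    have h1 := congrArg Complex.re hexpK
    have h2 := congrArg Complex.im hexpK
    simp only [Complex.exp_re, Complex.exp_im, Complex.neg_re, Complex.neg_im, Complex.one_re,
      Complex.one_im, neg_zero, mul_eq_zero, Real.exp_ne_zero, false_or] at h1 h2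
    obtain ⟨n, hn⟩ := Real.sin_eq_zero_iff.1 h2
    have hn0 : 0 < n := by
      have : (0 : ℝ) < n := by
        by_contra h
        nlinarith [Real.pi_pos]
      exact_mod_cast this
    have hn2 : n < 2 := by
      have : (n : ℝ) < 2 := by
        by_contra h
        nlinarith [Real.pi_pos]
      exact_mod_cast this
    have : n = 1 := by omega
    rw [← hn, this]
    simp
  have hθper : ∀ s, θ (s + L) = θ s + 2 * Real.pi := fun s => by rw [hθL, hKpi]
  have hdet : ∀ x, planeDet (deriv α t) (deriv α x) =
      Real.exp (Λ (t, 0)).re * Real.exp (Λ (x, 0)).re * Real.sin (θ x - θ t) := fun x => by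
    rw [← hV00, ← hV00, ← hΛ, ← hΛ, planeDet_exp]
  have hy : ∀ x, HasDerivAt (fun x => planeDet (deriv α t) (α x - α t))
      (planeDet (deriv α t) (deriv α x)) x := by
    intro x
    have h1 := (hdiff x).sub_const (α t)
    have hre : HasDerivAt (fun x => (α x - α t).re) (deriv α x).re x :=
      Complex.reCLM.hasFDerivAt.comp_hasDerivAt x h1
    have him : HasDerivAt (fun x => (α x - α t).im) (deriv α x).im x :=
      Complex.imCLM.hasFDerivAt.comp_hasDerivAt x h1
    exact (him.const_mul _).sub (hre.const_mul _)
  have hyc : Continuous fun x => planeDet (deriv α t) (α x - α t) :=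
    continuous_iff_continuousAt.2 fun x => (hy x).continuousAt
  have hpos : ∀ x, 0 < Real.exp (Λ (t, 0)).re * Real.exp (Λ (x, 0)).re := fun x => by positivity
  have hy0 : planeDet (deriv α t) (α t - α t) = 0 := by simp [planeDet]
  -- The distance to the tangent line at `t`, up to a positive factor, increases from `0` until the
  -- tangent has turned by `π`, then decreases to `0` at `t + L`.
  rcases le_or_gt (θ s) (θ t + Real.pi) with h | h
  · have hm := strictMonoOn_of_deriv_pos (convex_Icc t s) hyc.continuousOn (fun x hx => by
      rw [interior_Icc] at hx
      rw [(hy x).deriv, hdet]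
      refine mul_pos (hpos x) (Real.sin_pos_of_pos_of_lt_pi ?_ ?_)
      · linarith [hθmono hx.1]
      · linarith [hθmono hx.2])
    have := hm (left_mem_Icc.2 hts.le) (right_mem_Icc.2 hts.le) hts
    simp only [hy0] at this
    exact this
  · have hm := strictAntiOn_of_deriv_neg (convex_Icc s (t + L)) hyc.continuousOn (fun x hx => by
      rw [interior_Icc] at hx
      rw [(hy x).deriv, hdet]
      refine mul_neg_of_pos_of_neg (hpos x) ?_
      rw [← Real.sin_sub_two_pi]
      refine Real.sin_neg_of_neg_of_neg_pi_lt ?_ ?_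
      · linarith [hθmono hx.2, hθper t]
      · linarith [hθmono hx.1])
    have := hm (left_mem_Icc.2 hsL.le) (right_mem_Icc.2 hsL.le) hsL
    simp only [hper t, hy0] at this
    exact this

end PlaneCurves

section PlaneCurveOrientation

theorem planeDet_conj (a b : ℂ) :
    planeDet (starRingEnd ℂ a) (starRingEnd ℂ b) = -planeDet a b := by
  simp [planeDet]; ring

/-- A simple closed plane curve without inflection lies on one side of each of its tangents, and
always on the same side. -/
theorem planeDet_pos_or_neg_of_simple_closed {α : ℝ → ℂ} {L : ℝ} (hL : 0 < L)
    (hα : ContDiff ℝ 2 α) (hper : Function.Periodic α L) (hinj : InjOn α (Ico 0 L))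
    (hcurv : ∀ t, planeDet (deriv α t) (deriv (deriv α) t) ≠ 0) :
    (∀ t s, t < s → s < t + L → 0 < planeDet (deriv α t) (α s - α t)) ∨
      ∀ t s, t < s → s < t + L → planeDet (deriv α t) (α s - α t) < 0 := by
  have h1 : ContDiff ℝ 1 (deriv α) := ((contDiff_succ_iff_deriv (n := 1)).1 hα).2.2
  have hc : Continuous fun t => planeDet (deriv α t) (deriv (deriv α) t) := by
    have h2 : Continuous (deriv (deriv α)) := h1.continuous_deriv le_rfl
    have h3 : Continuous (deriv α) := h1.continuous
    unfold planeDet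
    fun_prop
  have hsign : (∀ t, 0 < planeDet (deriv α t) (deriv (deriv α) t)) ∨
      ∀ t, planeDet (deriv α t) (deriv (deriv α) t) < 0 := by
    rcases (hcurv 0).lt_or_gt with h | h
    · refine Or.inr fun t => ?_
      by_contra hcon
      obtain ⟨x, hx⟩ := mem_range_of_exists_le_of_exists_ge hc ⟨0, h.le⟩ ⟨t, not_lt.1 hcon⟩
      exact hcurv x hx
    · refine Or.inl fun t => ?_
      by_contra hcon
      obtain ⟨x, hx⟩ := mem_range_of_exists_le_of_exists_ge hc ⟨t, not_lt.1 hcon⟩ ⟨0, h.le⟩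
      exact hcurv x hx
  rcases hsign with h | h
  · exact Or.inl fun t s => planeDet_pos_of_simple_closed hL hα hper hinj h
  · refine Or.inr fun t s hts hsL => ?_
    -- Conjugation reverses orientation and reduces this case to positive curvature.
    let β : ℝ → ℂ := fun t => starRingEnd ℂ (α t)
    have hβ : ContDiff ℝ 2 β := Complex.conjCLE.contDiff.comp hα
    have hd1 : deriv β = fun t => starRingEnd ℂ (deriv α t) := funext fun t =>
      (Complex.conjCLE.toContinuousLinearMap.hasFDerivAt.comp_hasDerivAt t
        ((hα.differentiable (by simp) t).hasDerivAt)).deriv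
    have hd2 : deriv (deriv β) = fun t => starRingEnd ℂ (deriv (deriv α) t) := by
      rw [hd1]
      exact funext fun t => (Complex.conjCLE.toContinuousLinearMap.hasFDerivAt.comp_hasDerivAt t
        ((h1.differentiable (by simp) t).hasDerivAt)).deriv
    have := planeDet_pos_of_simple_closed (α := β) hL hβ (fun t => by simp only [β, hper t])
      (fun x hx y hy hxy => hinj hx hy ((starRingEnd ℂ).injective hxy))
      (fun t => by rw [hd2, hd1, planeDet_conj]; linarith [h t]) hts hsL
    simp only [hd1, β, ← map_sub, planeDet_conj] at this
    linarith

end PlaneCurveOrientation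

/-- A monotone function with equal values at the ends of an interval is constant on it. -/
theorem hasDerivAt_eq_zero_of_nonneg {f f' : ℝ → ℝ} (hf : ∀ t, HasDerivAt f (f' t) t) {a b : ℝ}
    (hab : f a = f b) (hnonneg : ∀ t ∈ Ioo a b, 0 ≤ f' t) {t : ℝ} (ht : t ∈ Ioo a b) :
    f' t = 0 := by
  have hle : a ≤ b := (ht.1.trans ht.2).le
  have hmono : MonotoneOn f (Icc a b) := monotoneOn_of_deriv_nonneg (convex_Icc a b)
    (fun x _ => (hf x).continuousAt.continuousWithinAt)
    (fun x _ => (hf x).differentiableAt.differentiableWithinAt)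
    (fun x hx => by rw [(hf x).deriv]; exact hnonneg x (by rwa [interior_Icc] at hx))
  have hconst : f =ᶠ[𝓝 t] fun _ => f a := by
    filter_upwards [Icc_mem_nhds ht.1 ht.2] with x hx
    refine le_antisymm ?_ (hmono (left_mem_Icc.2 hle) hx hx.1)
    rw [hab]
    exact hmono hx (right_mem_Icc.2 hle) hx.2
  exact (hf t).unique ((hasDerivAt_const t (f a)).congr_of_eventuallyEq hconst)

/-! ### Lorentzian vector algebra -/

namespace Minkowski

theorem lorentz_comm (u v : R21) : lorentz u v = lorentz v u := by
  simp only [lorentz]; ring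

theorem lorentz_smul_left (c : ℝ) (u v : R21) : lorentz (c • u) v = c * lorentz u v := by
  simp [lorentz]; ring

theorem lorentz_add_right (u v w : R21) : lorentz u (v + w) = lorentz u v + lorentz u w := by
  simp [lorentz]; ring

theorem lorentz_smul_right (c : ℝ) (u v : R21) : lorentz u (c • v) = c * lorentz u v := by
  simp [lorentz]; ring

theorem cross_self (u : R21) : cross u u = 0 := by
  ext i; fin_cases i <;> simp [cross] <;> ring

theorem cross_smul_left (c : ℝ) (u v : R21) : cross (c • u) v = c • cross u v := by
  ext i; fin_cases i <;> simp [cross] <;> ring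

theorem cross_smul_right (c : ℝ) (u v : R21) : cross u (c • v) = c • cross u v := by
  ext i; fin_cases i <;> simp [cross] <;> ring

theorem cross_add_right (u v w : R21) : cross u (v + w) = cross u v + cross u w := by
  ext i; fin_cases i <;> simp [cross] <;> ring

theorem lorentz_cross_left (u v : R21) : lorentz (cross u v) u = 0 := by
  simp [lorentz, cross]; ring

/-- Lagrange's identity with the Euclidean sign reversed; it makes the normal of a spacelike plane
timelike. -/
theorem lorentz_cross_cross (u v : R21) :
    lorentz (cross u v) (cross u v) = lorentz u v ^ 2 - lorentz u u * lorentz v v := by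
  simp [lorentz, cross]; ring

theorem cross_cross (u v : R21) :
    cross u (cross u v) = lorentz u u • v - lorentz u v • u := by
  ext i; fin_cases i <;> simp [cross, lorentz] <;> ring

theorem cross_cross' (u v : R21) :
    cross v (cross u v) = lorentz u v • v - lorentz v v • u := by
  ext i; fin_cases i <;> simp [cross, lorentz] <;> ring

/-- The expansion of a vector in the frame `u`, `v`, `u × v`. -/
theorem gram_smul_eq (u v w : R21) :
    (lorentz u u * lorentz v v - lorentz u v ^ 2) • w =
      (lorentz w u * lorentz v v - lorentz w v * lorentz u v) • u +
        (lorentz w v * lorentz u u - lorentz w u * lorentz u v) • v -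
          lorentz w (cross u v) • cross u v := by
  ext i; fin_cases i <;> simp [cross, lorentz] <;> ring

theorem hasDerivAt_lorentz {X Y : ℝ → R21} {X' Y' : R21} {t : ℝ} (hX : HasDerivAt X X' t)
    (hY : HasDerivAt Y Y' t) :
    HasDerivAt (fun t => lorentz (X t) (Y t)) (lorentz X' (Y t) + lorentz (X t) Y') t := by
  have hXi : ∀ i, HasDerivAt (fun t => X t i) (X' i) t := fun i =>
    (EuclideanSpace.proj i : R21 →L[ℝ] ℝ).hasFDerivAt.comp_hasDerivAt t hX
  have hYi : ∀ i, HasDerivAt (fun t => Y t i) (Y' i) t := fun i =>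
    (EuclideanSpace.proj i : R21 →L[ℝ] ℝ).hasFDerivAt.comp_hasDerivAt t hY
  refine ((((hXi 0).mul (hYi 0)).add ((hXi 1).mul (hYi 1))).sub ((hXi 2).mul (hYi 2))).congr_deriv ?_
  simp only [lorentz]
  ring

theorem hasDerivAt_cross {X Y : ℝ → R21} {X' Y' : R21} {t : ℝ} (hX : HasDerivAt X X' t)
    (hY : HasDerivAt Y Y' t) :
    HasDerivAt (fun t => cross (X t) (Y t)) (cross X' (Y t) + cross (X t) Y') t := by
  have hXi : ∀ i, HasDerivAt (fun t => X t i) (X' i) t := fun i =>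
    (EuclideanSpace.proj i : R21 →L[ℝ] ℝ).hasFDerivAt.comp_hasDerivAt t hX
  have hYi : ∀ i, HasDerivAt (fun t => Y t i) (Y' i) t := fun i =>
    (EuclideanSpace.proj i : R21 →L[ℝ] ℝ).hasFDerivAt.comp_hasDerivAt t hY
  rw [hasDerivAt_iff_hasFDerivAt, ← hasFDerivWithinAt_univ, hasFDerivWithinAt_euclidean]
  simp only [hasFDerivWithinAt_univ]
  intro i
  have h : ∀ {f : ℝ → ℝ} {a : ℝ}, HasDerivAt f a t → a = (cross X' (Y t) + cross (X t) Y') i →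
      HasFDerivAt f ((EuclideanSpace.proj i : R21 →L[ℝ] ℝ) ∘L
        ContinuousLinearMap.toSpanSingleton ℝ (cross X' (Y t) + cross (X t) Y')) t := by
    intro f a hf ha
    refine hf.hasFDerivAt.congr_fderiv (ContinuousLinearMap.ext_ring ?_)
    simp [ha]
  fin_cases i
  · refine h (((hXi 1).mul (hYi 2)).sub ((hXi 2).mul (hYi 1))) ?_
    simp [cross]; ring
  · refine h (((hXi 2).mul (hYi 0)).sub ((hXi 0).mul (hYi 2))) ?_
    simp [cross]; ring
  · refine h (((hXi 0).mul (hYi 1)).sub ((hXi 1).mul (hYi 0))).neg ?_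
    simp [cross]; ring

theorem contDiff_lorentz {X Y : ℝ → R21} {n : WithTop ℕ∞} (hX : ContDiff ℝ n X)
    (hY : ContDiff ℝ n Y) : ContDiff ℝ n fun t => lorentz (X t) (Y t) := by
  have hXi := fun i => (contDiff_euclidean.1 hX) i
  have hYi := fun i => (contDiff_euclidean.1 hY) i
  exact (((hXi 0).mul (hYi 0)).add ((hXi 1).mul (hYi 1))).sub ((hXi 2).mul (hYi 2))

/-! ### Frenet frame, osculating planes and torsion -/

section Frenet

variable {γ : ℝ → R21}

theorem periodic_arcDeriv {X : ℝ → R21} {L : ℝ} (hγ : Function.Periodic γ L)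
    (hX : Function.Periodic X L) : Function.Periodic (arcDeriv γ X) L := by
  have hd : ∀ {Y : ℝ → R21}, Function.Periodic Y L → Function.Periodic (deriv Y) L := by
    intro Y hY x
    rw [← deriv_comp_add_const]
    exact congrArg (fun f => deriv f x) (funext hY)
  intro t
  simp only [arcDeriv, speed, hd hγ t, hd hX t]

theorem periodic_binormal {L : ℝ} (hγ : Function.Periodic γ L) :
    Function.Periodic (binormal γ) L := by
  have hT : Function.Periodic (tangent γ) L := periodic_arcDeriv hγ hγ
  have hK : Function.Periodic (curvatureVector γ) L := periodic_arcDeriv hγ hT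
  intro t
  simp only [binormal, normal, curvature, hT t, hK t]

/-- If `γ'` is not spacelike, the square root and the inverse take the value `0`, so the curvature
vector vanishes and is not spacelike. The curvature hypothesis thus already forces `γ` to be
spacelike. -/
theorem speed_pos_of_isSpacelike_curvatureVector {t : ℝ}
    (h : IsSpacelike (curvatureVector γ t)) : 0 < speed γ t := by
  refine (Real.sqrt_nonneg _).lt_of_ne' fun h0 => ?_
  have : curvatureVector γ t = 0 := by
    rw [curvatureVector, arcDeriv]
    rw [speed, h0, inv_zero, zero_smul]
  rw [this, IsSpacelike] at h
  simp [lorentz] at h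

theorem speed_sq {t : ℝ} (h : 0 < speed γ t) :
    speed γ t ^ 2 = lorentz (deriv γ t) (deriv γ t) :=
  Real.sq_sqrt (Real.sqrt_pos.1 h).le

theorem deriv_eq_speed_smul_tangent {t : ℝ} (h : 0 < speed γ t) :
    deriv γ t = speed γ t • tangent γ t := by
  rw [tangent, arcDeriv, smul_inv_smul₀ h.ne']

theorem lorentz_tangent_tangent {t : ℝ} (h : 0 < speed γ t) :
    lorentz (tangent γ t) (tangent γ t) = 1 := by
  rw [tangent, arcDeriv, lorentz_smul_smul, ← speed_sq h, inv_pow,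
    inv_mul_cancel₀ (pow_pos h 2).ne']

theorem curvature_pos (hcurv : ∀ t, IsSpacelike (curvatureVector γ t)) (t : ℝ) :
    0 < curvature γ t := Real.sqrt_pos.2 (hcurv t)

theorem curvatureVector_eq (hcurv : ∀ t, IsSpacelike (curvatureVector γ t)) (t : ℝ) :
    curvatureVector γ t = curvature γ t • normal γ t := by
  rw [normal, smul_inv_smul₀ (curvature_pos hcurv t).ne']

theorem lorentz_normal_normal (hcurv : ∀ t, IsSpacelike (curvatureVector γ t)) (t : ℝ) :
    lorentz (normal γ t) (normal γ t) = 1 := by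
  have h : curvature γ t ^ 2 = lorentz (curvatureVector γ t) (curvatureVector γ t) :=
    Real.sq_sqrt (hcurv t).le
  rw [normal, lorentz_smul_smul, ← h, inv_pow,
    inv_mul_cancel₀ (pow_pos (curvature_pos hcurv t) 2).ne']

theorem deriv_tangent (hcurv : ∀ t, IsSpacelike (curvatureVector γ t)) (t : ℝ) :
    deriv (tangent γ) t = (speed γ t * curvature γ t) • normal γ t := by
  have hv := speed_pos_of_isSpacelike_curvatureVector (hcurv t)
  rw [mul_smul, ← curvatureVector_eq hcurv, curvatureVector, arcDeriv, smul_inv_smul₀ hv.ne']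

theorem lorentz_binormal_deriv (hcurv : ∀ t, IsSpacelike (curvatureVector γ t)) (t : ℝ) :
    lorentz (binormal γ t) (deriv γ t) = 0 := by
  rw [deriv_eq_speed_smul_tangent (speed_pos_of_isSpacelike_curvatureVector (hcurv t)),
    lorentz_smul_right, binormal, lorentz_cross_left, mul_zero]

theorem deriv_shadow (hγ : ContDiff ℝ ∞ γ) (t : ℝ) :
    deriv (fun t => shadow (γ t)) t = shadow (deriv γ t) :=
  (shadow.hasFDerivAt.comp_hasDerivAt t ((hγ.differentiable (by simp) t).hasDerivAt)).deriv

variable (hγ : ContDiff ℝ ∞ γ) (hcurv : ∀ t, IsSpacelike (curvatureVector γ t))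
include hγ hcurv

theorem contDiff_arcDeriv {X : ℝ → R21} (hX : ContDiff ℝ ∞ X) : ContDiff ℝ ∞ (arcDeriv γ X) := by
  have hdγ : ContDiff ℝ ∞ (deriv γ) := (contDiff_infty_iff_deriv.1 hγ).2
  have hv : ∀ t, 0 < speed γ t := fun t => speed_pos_of_isSpacelike_curvatureVector (hcurv t)
  have hs : ContDiff ℝ ∞ (speed γ) :=
    (contDiff_lorentz hdγ hdγ).sqrt fun t => (Real.sqrt_pos.1 (hv t)).ne'
  exact (hs.inv fun t => (hv t).ne').smul (contDiff_infty_iff_deriv.1 hX).2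

theorem contDiff_tangent : ContDiff ℝ ∞ (tangent γ) := contDiff_arcDeriv hγ hcurv hγ

theorem contDiff_normal : ContDiff ℝ ∞ (normal γ) := by
  have h : ContDiff ℝ ∞ (curvatureVector γ) :=
    contDiff_arcDeriv hγ hcurv (contDiff_tangent hγ hcurv)
  have hk : ContDiff ℝ ∞ (curvature γ) := (contDiff_lorentz h h).sqrt fun t => (hcurv t).ne'
  exact (hk.inv fun t => (curvature_pos hcurv t).ne').smul h

theorem hasDerivAt_tangent (t : ℝ) :
    HasDerivAt (tangent γ) ((speed γ t * curvature γ t) • normal γ t) t := by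
  rw [← deriv_tangent hcurv]
  exact ((contDiff_tangent hγ hcurv).differentiable (by simp) t).hasDerivAt

theorem lorentz_tangent_normal (t : ℝ) : lorentz (tangent γ t) (normal γ t) = 0 := by
  have hv := fun t => speed_pos_of_isSpacelike_curvatureVector (hcurv t)
  have h1 := hasDerivAt_lorentz (hasDerivAt_tangent hγ hcurv t) (hasDerivAt_tangent hγ hcurv t)
  have h2 : (fun t => lorentz (tangent γ t) (tangent γ t)) = fun _ => 1 :=
    funext fun t => lorentz_tangent_tangent (hv t)
  rw [h2] at h1
  have h3 := h1.unique (hasDerivAt_const t 1)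
  rw [lorentz_smul_left, lorentz_smul_right, lorentz_comm (normal γ t)] at h3
  have hpos := mul_pos (hv t) (curvature_pos hcurv t)
  have h4 : (speed γ t * curvature γ t) * lorentz (tangent γ t) (normal γ t) = 0 := by linarith
  exact (mul_eq_zero.1 h4).resolve_left hpos.ne'

theorem lorentz_binormal_binormal (t : ℝ) : lorentz (binormal γ t) (binormal γ t) = -1 := by
  rw [binormal, lorentz_cross_cross, lorentz_tangent_normal hγ hcurv, lorentz_normal_normal hcurv,
    lorentz_tangent_tangent (speed_pos_of_isSpacelike_curvatureVector (hcurv t))]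
  norm_num

/-- A timelike vector is not horizontal, so the osculating plane contains no vertical line and meets
each one exactly once. -/
theorem binormal_time_ne_zero (t : ℝ) : binormal γ t 2 ≠ 0 := by
  intro h
  have := lorentz_binormal_binormal hγ hcurv t
  rw [lorentz, h] at this
  nlinarith [mul_self_nonneg (binormal γ t 0), mul_self_nonneg (binormal γ t 1)]

theorem cross_tangent_binormal (t : ℝ) : cross (tangent γ t) (binormal γ t) = normal γ t := by
  rw [binormal, cross_cross, lorentz_tangent_normal hγ hcurv,
    lorentz_tangent_tangent (speed_pos_of_isSpacelike_curvatureVector (hcurv t))]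
  simp

theorem cross_normal_binormal (t : ℝ) : cross (normal γ t) (binormal γ t) = -tangent γ t := by
  rw [binormal, cross_cross', lorentz_tangent_normal hγ hcurv, lorentz_normal_normal hcurv]
  simp

/-- The Frenet formula `dN/ds = -κ T + τ B`. -/
theorem hasDerivAt_normal (t : ℝ) :
    HasDerivAt (normal γ) (-(speed γ t * curvature γ t) • tangent γ t +
      (speed γ t * torsion γ t) • binormal γ t) t := by
  have hv := speed_pos_of_isSpacelike_curvatureVector (hcurv t)
  have hN : HasDerivAt (normal γ) (deriv (normal γ) t) t :=
    ((contDiff_normal hγ hcurv).differentiable (by simp) t).hasDerivAt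
  have h1 : lorentz (deriv (normal γ) t) (normal γ t) = 0 := by
    have h2 := hasDerivAt_lorentz hN hN
    have h3 : (fun t => lorentz (normal γ t) (normal γ t)) = fun _ => 1 :=
      funext fun t => lorentz_normal_normal hcurv t
    rw [h3] at h2
    have h4 := h2.unique (hasDerivAt_const t 1)
    rw [lorentz_comm (normal γ t)] at h4
    linarith
  have h2 : lorentz (deriv (normal γ) t) (tangent γ t) = -(speed γ t * curvature γ t) := by
    have h2 := hasDerivAt_lorentz (hasDerivAt_tangent hγ hcurv t) hN
    have h3 : (fun t => lorentz (tangent γ t) (normal γ t)) = fun _ => 0 :=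
      funext fun t => lorentz_tangent_normal hγ hcurv t
    rw [h3] at h2
    have h4 := h2.unique (hasDerivAt_const t 0)
    rw [lorentz_smul_left, lorentz_normal_normal hcurv, lorentz_comm (tangent γ t)] at h4
    linarith
  have h3 : speed γ t * torsion γ t = -lorentz (deriv (normal γ) t) (binormal γ t) := by
    rw [torsion, arcDeriv, lorentz_smul_left]
    field_simp
  have h4 := gram_smul_eq (tangent γ t) (normal γ t) (deriv (normal γ) t)
  rw [lorentz_tangent_normal hγ hcurv, lorentz_normal_normal hcurv, lorentz_tangent_tangent hv,
    h1, h2, ← binormal] at h4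
  rw [h3]
  rw [show (1 * 1 - 0 ^ 2 : ℝ) = 1 by norm_num, one_smul] at h4
  refine hN.congr_deriv (h4.trans ?_)
  module

/-- The Frenet formula `dB/ds = τ N`. -/
theorem hasDerivAt_binormal (t : ℝ) :
    HasDerivAt (binormal γ) ((speed γ t * torsion γ t) • normal γ t) t := by
  have h := hasDerivAt_cross (hasDerivAt_tangent hγ hcurv t) (hasDerivAt_normal hγ hcurv t)
  refine h.congr_deriv ?_
  rw [cross_smul_left, cross_self, cross_add_right, cross_smul_right, cross_smul_right, cross_self,
    cross_tangent_binormal hγ hcurv]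
  simp

/-- The derivative of the height, along the time axis, of the osculating plane at `γ t` over a
fixed point `p`. -/
theorem hasDerivAt_osculating_height (p : R21) (t : ℝ) :
    HasDerivAt (fun t => lorentz (binormal γ t) (γ t - p) / binormal γ t 2)
      (torsion γ t * planeDet (shadow (γ t - p)) (shadow (deriv γ t)) / binormal γ t 2 ^ 2) t := by
  have hB := hasDerivAt_binormal hγ hcurv t
  have hB2 : HasDerivAt (fun t => binormal γ t 2) (((speed γ t * torsion γ t) • normal γ t) 2) t :=
    (EuclideanSpace.proj 2 : R21 →L[ℝ] ℝ).hasFDerivAt.comp_hasDerivAt t hB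
  have hγt : HasDerivAt (fun t => γ t - p) (deriv γ t) t :=
    ((hγ.differentiable (by simp) t).hasDerivAt).sub_const p
  refine ((hasDerivAt_lorentz hB hγt).div hB2 (binormal_time_ne_zero hγ hcurv t)).congr_deriv ?_
  rw [lorentz_binormal_deriv hcurv, add_zero]
  congr 1
  -- The numerator is `speed * τ` times `⟨B₂ N - N₂ B, γ - p⟩`. The time component of `B₂ N - N₂ B`
  -- is zero, and the other two are, up to order and sign, components of `N × B = -T`.
  have hc := cross_normal_binormal hγ hcurv t
  have h0 : normal γ t 1 * binormal γ t 2 - normal γ t 2 * binormal γ t 1 = -tangent γ t 0 := by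
    simpa [cross] using congrArg (fun x : R21 => x 0) hc
  have h1 : normal γ t 2 * binormal γ t 0 - normal γ t 0 * binormal γ t 2 = -tangent γ t 1 := by
    simpa [cross] using congrArg (fun x : R21 => x 1) hc
  rw [deriv_eq_speed_smul_tangent (speed_pos_of_isSpacelike_curvatureVector (hcurv t))]
  simp only [planeDet, lorentz, shadow_re, shadow_im, PiLp.smul_apply, smul_eq_mul]
  linear_combination (speed γ t * torsion γ t) * ((γ t - p) 1 * h0 - (γ t - p) 0 * h1)

/-- With `v` the speed, the determinant equals `-v³ κ B₂`; the term in `v'` is parallel to the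
tangent and drops out. -/
theorem planeDet_shadow_deriv_ne_zero (t : ℝ) :
    planeDet (deriv (fun t => shadow (γ t)) t) (deriv (deriv fun t => shadow (γ t)) t) ≠ 0 := by
  have hv := fun t => speed_pos_of_isSpacelike_curvatureVector (hcurv t)
  have h1 : (deriv fun t => shadow (γ t)) = fun t => speed γ t • shadow (tangent γ t) := by
    ext t
    rw [deriv_shadow hγ, deriv_eq_speed_smul_tangent (hv t), map_smul]
  have hdγ : ContDiff ℝ ∞ (deriv γ) := (contDiff_infty_iff_deriv.1 hγ).2
  have hs : Differentiable ℝ (speed γ) :=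
    ((contDiff_lorentz hdγ hdγ).sqrt fun t => (Real.sqrt_pos.1 (hv t)).ne').differentiable (by simp)
  have h2 := (hs t).hasDerivAt.smul
    (shadow.hasFDerivAt.comp_hasDerivAt t (hasDerivAt_tangent hγ hcurv t))
  rw [h1]
  erw [h2.deriv]
  have h3 : binormal γ t 2 = -planeDet (shadow (tangent γ t)) (shadow (normal γ t)) := by
    simp [binormal, cross, planeDet]
  have h4 : planeDet (speed γ t • shadow (tangent γ t)) (speed γ t •
      shadow ((speed γ t * curvature γ t) • normal γ t) + deriv (speed γ) t • shadow (tangent γ t))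
      = -(speed γ t ^ 3 * curvature γ t * binormal γ t 2) := by
    rw [h3]
    simp [planeDet]
    ring
  refine (h4.trans_ne (neg_ne_zero.2 ?_))
  have := curvature_pos hcurv t
  have := hv t
  have := binormal_time_ne_zero hγ hcurv t
  positivity

/-- A curve without torsion lies in a plane. -/
theorem exists_plane_of_torsion_eq_zero (htors : ∀ t, torsion γ t = 0) :
    ∃ P : AffineSubspace ℝ R21, Module.finrank ℝ P.direction = 2 ∧ ∀ t, γ t ∈ P := by
  have hB : ∀ t, binormal γ t = binormal γ 0 := by
    refine fun t => is_const_of_deriv_eq_zero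
      (fun t => (hasDerivAt_binormal hγ hcurv t).differentiableAt) (fun t => ?_) t 0
    rw [(hasDerivAt_binormal hγ hcurv t).deriv, htors, mul_zero, zero_smul]
  let f : R21 →ₗ[ℝ] ℝ :=
    { toFun := lorentz (binormal γ 0)
      map_add' := lorentz_add_right _
      map_smul' := fun c x => lorentz_smul_right c _ x }
  -- Hence `f` is nonzero and its kernel has dimension two.
  have hf : f (binormal γ 0) = -1 := lorentz_binormal_binormal hγ hcurv 0
  have hsurj : Function.Surjective f := by
    refine LinearMap.surjective fun h => ?_
    rw [h] at hf
    simp at hf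
  refine ⟨AffineSubspace.mk' (γ 0) (LinearMap.ker f), ?_, fun t => ?_⟩
  · rw [AffineSubspace.direction_mk']
    have := f.finrank_range_add_finrank_ker
    rw [LinearMap.range_eq_top.2 hsurj] at this
    simp at this
    omega
  · rw [AffineSubspace.mem_mk', LinearMap.mem_ker, vsub_eq_sub]
    have hd : ∀ t, HasDerivAt (fun t => f (γ t)) 0 t := fun t => by
      have h := hasDerivAt_lorentz (hasDerivAt_const t (binormal γ 0))
        ((hγ.differentiable (by simp) t).hasDerivAt)
      refine h.congr_deriv ?_
      rw [← hB t, lorentz_binormal_deriv hcurv]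
      simp [lorentz]
    rw [map_sub, sub_eq_zero]
    exact is_const_of_deriv_eq_zero (fun t => (hd t).differentiableAt) (fun t => (hd t).deriv) t 0

/-- The torsion of a closed curve whose shadow is simple vanishes if it does not change sign. -/
theorem torsion_eq_zero_of_simple_shadow {L : ℝ} (hL : 0 < L) (hper : Function.Periodic γ L)
    (hinj : InjOn (fun t => shadow (γ t)) (Ico 0 L))
    (htors : (∀ t, 0 ≤ torsion γ t) ∨ ∀ t, torsion γ t ≤ 0) (t : ℝ) : torsion γ t = 0 := by
  have hsmooth : ContDiff ℝ ∞ fun t => shadow (γ t) := shadow.contDiff.comp hγ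
  have hsper : Function.Periodic (fun t => shadow (γ t)) L := fun t => congrArg shadow (hper t)
  have hconv := planeDet_pos_or_neg_of_simple_closed hL (contDiff_infty.1 hsmooth 2)
    hsper hinj (planeDet_shadow_deriv_ne_zero hγ hcurv)
  -- Half a period away, so that `t` is the midpoint of the period `(a, a + L)` and the determinant
  -- `D` does not vanish at `t`.
  set p := γ (t - L / 2) with hp
  let a := t - L / 2
  let D : ℝ → ℝ := fun s => planeDet (shadow (γ s - p)) (shadow (deriv γ s))
  have hD : ∀ s, D s =
      planeDet (deriv (fun t => shadow (γ t)) s) (shadow (γ (a + L)) - shadow (γ s)) :=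
    fun s => by
      rw [deriv_shadow hγ, hper a]
      simp only [D, planeDet, map_sub, Complex.sub_re, Complex.sub_im, hp, a]
      ring
  -- Convexity for the tangent at `s`, with `p` taken as the point of parameter `a + L`, which lies
  -- in `(s, s + L)`.
  have hDsign : (∀ s ∈ Ioo a (a + L), 0 < D s) ∨ ∀ s ∈ Ioo a (a + L), D s < 0 := by
    refine hconv.imp ?_ ?_ <;>
    · intro h s hs
      rw [hD]
      exact h s (a + L) hs.2 (by linarith [hs.1])
  have ht : t ∈ Ioo a (a + L) := by constructor <;> simp only [a] <;> linarith
  have hDt : D t ≠ 0 := by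
    rcases hDsign with h | h
    · exact (h t ht).ne'
    · exact (h t ht).ne
  have hderiv := hasDerivAt_osculating_height hγ hcurv p
  have hend : lorentz (binormal γ a) (γ a - p) / binormal γ a 2 =
      lorentz (binormal γ (a + L)) (γ (a + L) - p) / binormal γ (a + L) 2 := by
    rw [hper a, periodic_binormal hper a]
  have hsq : ∀ s, 0 ≤ binormal γ s 2 ^ 2 := fun s => sq_nonneg _
  have hsign : (∀ s ∈ Ioo a (a + L), 0 ≤ torsion γ s * D s / binormal γ s 2 ^ 2) ∨
      ∀ s ∈ Ioo a (a + L), torsion γ s * D s / binormal γ s 2 ^ 2 ≤ 0 := by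
    rcases htors with h1 | h1 <;> rcases hDsign with h2 | h2
    · exact Or.inl fun s hs => div_nonneg (mul_nonneg (h1 s) (h2 s hs).le) (hsq s)
    · exact Or.inr fun s hs =>
        div_nonpos_of_nonpos_of_nonneg (mul_nonpos_of_nonneg_of_nonpos (h1 s) (h2 s hs).le) (hsq s)
    · exact Or.inr fun s hs =>
        div_nonpos_of_nonpos_of_nonneg (mul_nonpos_of_nonpos_of_nonneg (h1 s) (h2 s hs).le) (hsq s)
    · exact Or.inl fun s hs =>
        div_nonneg (mul_nonneg_of_nonpos_of_nonpos (h1 s) (h2 s hs).le) (hsq s)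
  have hzero : torsion γ t * D t / binormal γ t 2 ^ 2 = 0 := by
    rcases hsign with h | h
    · exact hasDerivAt_eq_zero_of_nonneg hderiv hend h ht
    · refine neg_eq_zero.1 (hasDerivAt_eq_zero_of_nonneg (fun s => (hderiv s).neg)
        (neg_inj.2 hend) (fun s hs => neg_nonneg.2 (h s hs)) ht)
  rcases div_eq_zero_iff.1 hzero with h | h
  · exact (mul_eq_zero.1 h).resolve_right hDt
  · exact absurd (pow_eq_zero_iff (two_ne_zero) |>.1 h) (binormal_time_ne_zero hγ hcurv t)

end Frenet

end Minkowski

theorem theorem2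
    {M : Type*} [TopologicalSpace M] [T2Space M] [SecondCountableTopology M] [ConnectedSpace M]
    [ChartedSpace (EuclideanSpace ℝ (Fin 2)) M] [IsManifold (𝓡 2) ∞ M]
    (F : M → Minkowski.R21) (hF : Minkowski.IsSpacelikeImmersion F)
    (hcomplete : Minkowski.IsCompleteInduced F)
    (γ : ℝ → Minkowski.R21) (L : ℝ) (hγ : Minkowski.IsSmoothSimpleClosedCurve γ L)
    (hγF : ∀ t, γ t ∈ Set.range F)
    (hcurv : ∀ t, Minkowski.IsSpacelike (Minkowski.curvatureVector γ t))
    (htors : (∀ t, 0 ≤ Minkowski.torsion γ t) ∨ (∀ t, Minkowski.torsion γ t ≤ 0)) :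
    (∀ t, Minkowski.torsion γ t = 0) ∧
      ∃ P : AffineSubspace ℝ Minkowski.R21,
        Module.finrank ℝ P.direction = 2 ∧ ∀ t, γ t ∈ P := by
  have hinj : Set.InjOn (fun t => Minkowski.shadow (γ t)) (Set.Ico 0 L) := by
    intro s hs t ht hst
    refine hγ.simple hs ht ?_
    obtain ⟨x, hx⟩ := hγF s
    obtain ⟨y, hy⟩ := hγF t
    have hxy : x = y := hF.injective_shadow hcomplete (by
      simp only [Function.comp_apply, hx, hy]
      exact hst)
    rw [← hx, ← hy, hxy]
  have hzero := Minkowski.torsion_eq_zero_of_simple_shadow hγ.smooth hcurv hγ.period_pos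
    hγ.periodic hinj htors
  exact ⟨hzero, Minkowski.exists_plane_of_torsion_eq_zero hγ.smooth hcurv hzero⟩
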